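/- Let $P(M,G)$ be a smooth principal bundle with projection $\mu:P\to M$ and right action $\kappa:P\times G\to P$ of the Lie group $G$ (finite-dimensional Hausdorff manifolds without boundary, everything $C^\infty$); write $\kappa_g=\kappa(\cdot,g)$, $\kappa_p=\kappa(p,\cdot)$, $pg=\kappa(p,g)$, and let $\pi^*:T^*P\to P$ be the cotangent bundle. Let $\mathrm{Aut}_0TP$ be the group of smooth vector bundle automorphisms $A$ of $TP$ covering $\mathrm{id}_P$, and let $\mathrm{Aut}_{TG}TP$ be the subgroup of those $A$ with $A(pg)\circ\Phi_{(g,X)}=\Phi_{(g,X)}\circ A(p)$ for all $p\in P$, $g\in G$, $X\in T_eG$, where $\Phi_{(g,X)}(v_p)=T\kappa_g(p)\bigl(v_p+T\kappa_p(e)X\bigr)$ is the action of $TG\cong G\ltimes T_eG$ on $TP$. A linear vector field on $T^*P$ is a pair of smooth vector fields $\xi$ on $T^*P$ and $\chi$ on $P$ such that $\xi:T^*P\to T(T^*P)$ is a morphism of vector bundles over $\chi:P\to TP$, where $T(T^*P)\to TP$ is the vector bundle with projection $T\pi^*$. A generalized canonical form is a smooth one-form $\gamma$ on $T^*P$ such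 that $\gamma_\varphi\neq0$ for every nonzero covector $\varphi$, $\ker T\pi^*(\varphi)\subset\ker\gamma_\varphi$ for every $\varphi\in T^*P$, and $\langle\gamma,\xi\rangle$ is a smooth fibrewise linear function for every linear vector field $(\xi,\chi)$; $\mathrm{Can}\,T^*P$ is the set of these forms. For $A\in\mathrm{Aut}_0TP$ let $A^*:T^*P\to T^*P$, $A^*\varphi=\varphi\circ A(\pi^*(\varphi))$, be its dual, and put $\langle\Theta(A)_\varphi,\xi_\varphi\rangle=\langle\varphi,A(\pi^*(\varphi))\,T\pi^*(\varphi)\xi_\varphi\rangle$ for $\xi_\varphi\in T_\varphi(T^*P)$, and $L^*_A\gamma=(A^*)^*\gamma$ for one-forms $\gamma$ on $T^*P$. The canonical form is $\gamma_0=\Theta(\mathrm{id})$. Put $\mathrm{Can}_{TG}T^*P=\Theta(\mathrm{Aut}_{TG}TP)$. Let $\Phi^*_g:T^*P\to T^*P$ be the cotangent lift of $\kappa_g$: for $p=\pi^*(\varphi)$, $\Phi^*_g(\varphi)$ is the covector $\varphi\circ (T\kappa_g(p))^{-1}$ at $pg$. For $X\in T_eG$ let $\xi^X$ be the fundamental vector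 field of this lifted action. Let $J_A:T^*P\to T_e^*G$, $\langle J_A(\varphi),X\rangle=\langle\Theta(A)_\varphi,\xi^X_\varphi\rangle$, be the momentum map given by the potential $\Theta(A)$ of $\omega_A=d\Theta(A)$, and let $J_0(\varphi)=\varphi\circ T\kappa_{\pi^*(\varphi)}(e)$ be the standard momentum map. Then, for every $A\in\mathrm{Aut}_0TP$, $\Theta(A)\in\mathrm{Can}\,T^*P$ and $J_A=J_0\circ A^*$; moreover: (i) For $A\in\mathrm{Aut}_0TP$: $\Theta(A)\in\mathrm{Can}_{TG}T^*P$ if and only if $(\Phi^*_g)^*\Theta(A)=\Theta(A)$ for all $g\in G$ and $J_A=J_0$. (ii) $L^*$ is a free left action of $\mathrm{Aut}_0TP$ on $\mathrm{Can}\,T^*P$, and $\mathrm{Can}_{TG}T^*P$ is the orbit $\{L^*_A\gamma_0: A\in\mathrm{Aut}_{TG}TP\}$ of $\gamma_0$ under the subgroup $\mathrm{Aut}_{TG}TP$. (iii) If $A\in\mathrm{Aut}_0TP$ and $L^*_A(\mathrm{Can}_{TG}T^*P)\subset\mathrm{Can}_{TG}T^*P$, then $A\in\mathrm{Aut}_{TG}TP$.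 -/

import Mathlib

open Bundle Manifold
open scoped ContDiff

noncomputable section

namespace GenCan

section General

variable {E : Type*} [NormedAddCommGroup E] [NormedSpace ℝ E]
  {H : Type*} [TopologicalSpace H] (I : ModelWithCorners ℝ E H)
  {X : Type*} [TopologicalSpace X] [ChartedSpace H X]
  {E' : Type*} [NormedAddCommGroup E'] [NormedSpace ℝ E']
  {H' : Type*} [TopologicalSpace H'] (I' : ModelWithCorners ℝ E' H')
  {Y : Type*} [TopologicalSpace Y] [ChartedSpace H' Y]

/-- The cotangent space `T*_x X`. -/
abbrev CotangentSpace (x : X) : Type _ := TangentSpace I x →L[ℝ] Trivial X ℝ x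

/-- The total space of the cotangent bundle `T*X`, with its vector bundle structure. -/
abbrev CotangentBundle (X : Type*) [TopologicalSpace X] [ChartedSpace H X]
    [IsManifold I 1 X] : Type _ :=
  TotalSpace (E →L[ℝ] ℝ) (fun x : X => CotangentSpace I x)

/-- The model of the manifold `T*X`. -/
abbrev cotModel : ModelWithCorners ℝ (E × (E →L[ℝ] ℝ)) (ModelProd H (E →L[ℝ] ℝ)) :=
  I.prod 𝓘(ℝ, E →L[ℝ] ℝ)

/-- (Not necessarily smooth) differential one-forms. -/
abbrev OneForm (X : Type*) [TopologicalSpace X] [ChartedSpace H X] : Type _ :=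
  (x : X) → TangentSpace I x →L[ℝ] ℝ

/-- (Not necessarily smooth) vector fields. -/
abbrev VField (X : Type*) [TopologicalSpace X] [ChartedSpace H X] : Type _ :=
  (x : X) → TangentSpace I x

variable {I I'}

/-- Smoothness of a one-form, as a section of the cotangent bundle. -/
def OneForm.IsSmooth [IsManifold I 1 X] (γ : OneForm I X) : Prop :=
  ContMDiff I (cotModel I) ∞ (fun x => (TotalSpace.mk x (γ x) : CotangentBundle I X))

/-- Smoothness of a vector field, as a section of the tangent bundle. -/
def VField.IsSmooth [IsManifold I 1 X] (χ : VField I X) : Prop :=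
  ContMDiff I I.tangent ∞ (fun x => (TotalSpace.mk x (χ x) : TangentBundle I X))

/-- The pullback `f^* γ` of a one-form. -/
def OneForm.pullback (f : X → Y) (γ : OneForm I' Y) : OneForm I X :=
  fun x => (γ (f x)).comp (mfderiv I I' f x)

end General

section Cotangent

variable {E : Type*} [NormedAddCommGroup E] [NormedSpace ℝ E]
  {H : Type*} [TopologicalSpace H] (I : ModelWithCorners ℝ E H)
  (P : Type*) [TopologicalSpace P] [ChartedSpace H P]

/-- The families of continuous linear automorphisms of the tangent spaces of `P`. -/
abbrev FibreAut : Type _ := (p : P) → TangentSpace I p ≃L[ℝ] TangentSpace I p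

variable {I P}

/-- `A(p)` depends smoothly on `p`: the section `A` of the bundle `End(TP)` is smooth. -/
def FibreAut.IsSmooth [IsManifold I 1 P] (A : FibreAut I P) : Prop :=
  ContMDiff I (I.prod 𝓘(ℝ, E →L[ℝ] E)) ∞
    (fun p => (TotalSpace.mk p (A p : TangentSpace I p →L[ℝ] TangentSpace I p) :
      TotalSpace (E →L[ℝ] E) (fun p : P => TangentSpace I p →L[ℝ] TangentSpace I p)))

theorem FibreAut.isSmooth_iff [IsManifold I ∞ P] {A : FibreAut I P} :
    A.IsSmooth ↔ ∀ p₀ : P, ContMDiffAt I 𝓘(ℝ, E →L[ℝ] E) ∞ (fun p =>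
      ContinuousLinearMap.inCoordinates E (TangentSpace I : P → Type _) E
        (TangentSpace I : P → Type _) p₀ p p₀ p
        (A p : TangentSpace I p →L[ℝ] TangentSpace I p)) p₀ := by
  unfold FibreAut.IsSmooth ContMDiff
  refine forall_congr' fun p₀ => ?_
  rw [contMDiffAt_hom_bundle]
  exact and_iff_right contMDiffAt_id

theorem FibreAut.eventually_inCoordinates [IsManifold I ∞ P] (p₀ : P) :
    ∀ᶠ p in nhds p₀, ∃ t : TangentSpace I p ≃L[ℝ] E,
      ∀ ϕ : TangentSpace I p →L[ℝ] TangentSpace I p,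
        ContinuousLinearMap.inCoordinates E (TangentSpace I : P → Type _) E
          (TangentSpace I : P → Type _) p₀ p p₀ p ϕ =
            (t : TangentSpace I p →L[ℝ] E).comp
              (ϕ.comp (t.symm : E →L[ℝ] TangentSpace I p)) := by
  filter_upwards [(trivializationAt E (TangentSpace I : P → Type _) p₀).open_baseSet.mem_nhds
    (FiberBundle.mem_baseSet_trivializationAt' p₀)] with p hp
  exact ⟨_, fun ϕ => ContinuousLinearMap.inCoordinates_eq hp hp⟩

theorem FibreAut.isSmooth_one [IsManifold I ∞ P] : (1 : FibreAut I P).IsSmooth := by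
  rw [FibreAut.isSmooth_iff]
  intro p₀
  refine (contMDiffAt_const (c := ContinuousLinearMap.id ℝ E)).congr_of_eventuallyEq ?_
  filter_upwards [FibreAut.eventually_inCoordinates (I := I) p₀] with p ⟨t, ht⟩
  rw [ht]
  ext v
  exact t.apply_symm_apply v

theorem FibreAut.IsSmooth.mul [IsManifold I ∞ P] {A B : FibreAut I P}
    (hA : A.IsSmooth) (hB : B.IsSmooth) : (A * B).IsSmooth := by
  rw [FibreAut.isSmooth_iff] at *
  intro p₀
  refine ((hA p₀).clm_comp (hB p₀)).congr_of_eventuallyEq ?_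
  filter_upwards [FibreAut.eventually_inCoordinates (I := I) p₀] with p ⟨t, ht⟩
  rw [ht, ht, ht]
  ext v
  change t (A p (B p (t.symm v))) = t (A p (t.symm (t (B p (t.symm v)))))
  rw [t.symm_apply_apply]

theorem FibreAut.IsSmooth.inv [FiniteDimensional ℝ E] [IsManifold I ∞ P] {A : FibreAut I P}
    (hA : A.IsSmooth) : (A⁻¹).IsSmooth := by
  have : CompleteSpace E := FiniteDimensional.complete ℝ E
  rw [FibreAut.isSmooth_iff] at *
  intro p₀
  have key : ∀ (p : P) (t : TangentSpace I p ≃L[ℝ] E),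
      (t : TangentSpace I p →L[ℝ] E).comp ((A p : TangentSpace I p →L[ℝ] TangentSpace I p).comp
        (t.symm : E →L[ℝ] TangentSpace I p)) =
      ((t.symm.trans ((A p).trans t) : E ≃L[ℝ] E) : E →L[ℝ] E) := fun p t => rfl
  have hinv : ContDiffAt ℝ ∞ ContinuousLinearMap.inverse
      (ContinuousLinearMap.inCoordinates E (TangentSpace I : P → Type _) E
        (TangentSpace I : P → Type _) p₀ p₀ p₀ p₀
        (A p₀ : TangentSpace I p₀ →L[ℝ] TangentSpace I p₀)) := by
    obtain ⟨t, ht⟩ := (FibreAut.eventually_inCoordinates (I := I) p₀).self_of_nhds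
    rw [ht, key]
    exact contDiffAt_map_inverse _
  refine (hinv.contMDiffAt.comp p₀ (hA p₀)).congr_of_eventuallyEq ?_
  filter_upwards [FibreAut.eventually_inCoordinates (I := I) p₀] with p ⟨t, ht⟩
  rw [Function.comp_apply, ht, ht, key, ContinuousLinearMap.inverse_equiv]
  rfl

variable (I P)

/-- The group `Aut₀ TP` of smooth automorphisms of `TP` covering the identity map of `P`. -/
def Aut0 [FiniteDimensional ℝ E] [IsManifold I ∞ P] : Subgroup (FibreAut I P) where
  carrier := {A | A.IsSmooth}
  one_mem' := FibreAut.isSmooth_one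
  mul_mem' := FibreAut.IsSmooth.mul
  inv_mem' := FibreAut.IsSmooth.inv

/-- The bundle projection `π^* : T*P → P`. -/
def cotProj [IsManifold I 1 P] : CotangentBundle I P → P := fun φ => φ.1

/-- The canonical one-form `γ₀` on `T*P`. -/
def canonicalForm [IsManifold I ∞ P] : OneForm (cotModel I) (CotangentBundle I P) :=
  fun φ => ContinuousLinearMap.comp φ.2 (mfderiv (cotModel I) I (cotProj I P) φ)

variable {I P}

/-- The one-form `Θ(A)` on `T*P`: `⟨Θ(A)_φ, ξ⟩ = ⟨φ, A(π^*(φ)) Tπ^*(φ) ξ⟩`. -/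
def Theta [IsManifold I ∞ P] (A : FibreAut I P) :
    OneForm (cotModel I) (CotangentBundle I P) :=
  fun φ => ContinuousLinearMap.comp φ.2
    ((A φ.1 : TangentSpace I φ.1 →L[ℝ] TangentSpace I φ.1).comp
      (mfderiv (cotModel I) I (cotProj I P) φ))

/-- The dual `A^* : T*P → T*P` of `A`. -/
def FibreAut.dual [IsManifold I 1 P] (A : FibreAut I P) :
    CotangentBundle I P → CotangentBundle I P :=
  fun φ => TotalSpace.mk φ.1
    (ContinuousLinearMap.comp φ.2 (A φ.1 : TangentSpace I φ.1 →L[ℝ] TangentSpace I φ.1))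

/-- `L^*_A γ`, the pullback of `γ` by `A^*`. -/
def Lstar [IsManifold I ∞ P] (A : FibreAut I P)
    (γ : OneForm (cotModel I) (CotangentBundle I P)) :
    OneForm (cotModel I) (CotangentBundle I P) :=
  OneForm.pullback A.dual γ

/-- The function `f` on `T*P` belongs to `Lin C^∞(T*P)`. -/
def IsLinFunction [IsManifold I ∞ P] (f : CotangentBundle I P → ℝ) : Prop :=
  ContMDiff (cotModel I) 𝓘(ℝ, ℝ) ∞ f ∧
    ∀ p : P, IsLinearMap ℝ (fun η : CotangentSpace I p => f (TotalSpace.mk p η))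

/-- The fibre coordinate `T*P → E*` of the preferred local trivialization of `T*P` at `p`. -/
def fibreCoord [IsManifold I ∞ P] (p : P) : CotangentBundle I P → (E →L[ℝ] ℝ) :=
  fun ψ => (trivializationAt (E →L[ℝ] ℝ) (fun x : P => CotangentSpace I x) p ψ).2

/-- `(ξ, χ)` is a linear vector field on `T*P`: the vector fields `ξ` and `χ` are smooth, and
`ξ : T*P → T(T*P)` is a morphism of vector bundles over `χ : P → TP`.  A local trivialization
`T*U ≅ U × E*` induces a local trivialization `T(T*U) ≅ TU × (E* × E*)` of the vector bundle
`Tπ^* : T(T*P) → TP`; in it `ξ` reads `φ ↦ (fibre coordinate of φ, its derivative along ξ)`,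
so that fibrewise linearity of `ξ` is linearity of the second component. -/
structure IsLinVField [IsManifold I ∞ P]
    (ξ : VField (cotModel I) (CotangentBundle I P)) (χ : VField I P) : Prop where
  smooth : ξ.IsSmooth
  smooth_base : χ.IsSmooth
  covers : ∀ φ : CotangentBundle I P, mfderiv (cotModel I) I (cotProj I P) φ (ξ φ) = χ φ.1
  linear : ∀ p : P, IsLinearMap ℝ (fun η : CotangentSpace I p =>
    (mfderiv (cotModel I) 𝓘(ℝ, E →L[ℝ] ℝ) (fibreCoord (I := I) p) (TotalSpace.mk p η)
      (ξ (TotalSpace.mk p η)) : E →L[ℝ] ℝ))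

/-- `γ` is a generalized canonical form on `T*P`. -/
structure IsGenCanonical [IsManifold I ∞ P]
    (γ : OneForm (cotModel I) (CotangentBundle I P)) : Prop where
  smooth : γ.IsSmooth
  /-- A fibrewise linear form vanishes on the zero section, so only `φ ≠ 0` is meant. -/
  ne_zero : ∀ φ : CotangentBundle I P, φ.2 ≠ 0 → γ φ ≠ 0
  ker_le : ∀ φ : CotangentBundle I P,
    LinearMap.ker (mfderiv (cotModel I) I (cotProj I P) φ).toLinearMap
      ≤ LinearMap.ker (γ φ).toLinearMap
  linear : ∀ ξ χ, IsLinVField ξ χ → IsLinFunction (fun φ => γ φ (ξ φ))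

variable (I P)

/-- The space `Can T*P` of generalized canonical forms. -/
def Can [IsManifold I ∞ P] : Set (OneForm (cotModel I) (CotangentBundle I P)) :=
  {γ | IsGenCanonical γ}

end Cotangent

/-- `L` restricts to a free left action of the subgroup `S` on the set `C`. -/
structure IsFreeActionOn {Γ X : Type*} [Group Γ] (S : Subgroup Γ) (C : Set X)
    (L : Γ → X → X) : Prop where
  maps : ∀ a ∈ S, ∀ x ∈ C, L a x ∈ C
  one : ∀ x ∈ C, L 1 x = x
  mul : ∀ a ∈ S, ∀ b ∈ S, ∀ x ∈ C, L (a * b) x = L a (L b x)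
  free : ∀ a ∈ S, ∀ x ∈ C, L a x = x → a = 1

section Principal

/-- A smooth principal `G`-bundle `μ : P → M` with right action `κ : P × G → P`. -/
structure PrincipalBundle
    {EP : Type*} [NormedAddCommGroup EP] [NormedSpace ℝ EP]
    {HP : Type*} [TopologicalSpace HP] (IP : ModelWithCorners ℝ EP HP)
    {EM : Type*} [NormedAddCommGroup EM] [NormedSpace ℝ EM]
    {HM : Type*} [TopologicalSpace HM] (IM : ModelWithCorners ℝ EM HM)
    {EG : Type*} [NormedAddCommGroup EG] [NormedSpace ℝ EG]
    {HG : Type*} [TopologicalSpace HG] (IG : ModelWithCorners ℝ EG HG)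
    (P : Type*) [TopologicalSpace P] [ChartedSpace HP P]
    (M : Type*) [TopologicalSpace M] [ChartedSpace HM M]
    (G : Type*) [TopologicalSpace G] [ChartedSpace HG G] [Group G] where
  /-- the bundle projection -/
  μ : P → M
  /-- the right action -/
  κ : P → G → P
  smooth_μ : ContMDiff IP IM ∞ μ
  smooth_κ : ContMDiff (IP.prod IG) IP ∞ (fun x : P × G => κ x.1 x.2)
  κ_one : ∀ p, κ p 1 = p
  κ_mul : ∀ p g h, κ p (g * h) = κ (κ p g) h
  /-- `G`-equivariant local trivializations `μ⁻¹(U) ≅ U × G` over `U` -/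
  locally_trivial : ∀ m : M, ∃ (U : Set M) (e : OpenPartialHomeomorph P (M × G)),
    IsOpen U ∧ m ∈ U ∧ e.source = μ ⁻¹' U ∧ e.target = U ×ˢ Set.univ ∧
    ContMDiffOn IP (IM.prod IG) ∞ e e.source ∧
    ContMDiffOn (IM.prod IG) IP ∞ e.symm e.target ∧
    (∀ p ∈ e.source, (e p).1 = μ p) ∧
    (∀ p ∈ e.source, ∀ g : G, e (κ p g) = ((e p).1, (e p).2 * g))

namespace PrincipalBundle

variable
    {EP : Type*} [NormedAddCommGroup EP] [NormedSpace ℝ EP]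
    {HP : Type*} [TopologicalSpace HP] {IP : ModelWithCorners ℝ EP HP}
    {EM : Type*} [NormedAddCommGroup EM] [NormedSpace ℝ EM]
    {HM : Type*} [TopologicalSpace HM] {IM : ModelWithCorners ℝ EM HM}
    {EG : Type*} [NormedAddCommGroup EG] [NormedSpace ℝ EG]
    {HG : Type*} [TopologicalSpace HG] {IG : ModelWithCorners ℝ EG HG}
    {P : Type*} [TopologicalSpace P] [ChartedSpace HP P]
    {M : Type*} [TopologicalSpace M] [ChartedSpace HM M]
    {G : Type*} [TopologicalSpace G] [ChartedSpace HG G] [Group G]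
    (B : PrincipalBundle IP IM IG P M G)

/-- `Tκ_g(p) : T_pP → T_{pg}P`. -/
def tangentRight (g : G) (p : P) : TangentSpace IP p →L[ℝ] TangentSpace IP (B.κ p g) :=
  mfderiv IP IP (fun q => B.κ q g) p

/-- `Tκ_p(e) : T_eG → T_pP`; here `κ_p(e) = p`. -/
def tangentOrbit (p : P) : GroupLieAlgebra IG G →L[ℝ] TangentSpace IP p :=
  (mfderiv IG IP (fun g => B.κ p g) (1 : G) :
    TangentSpace IG (1 : G) →L[ℝ] TangentSpace IP (B.κ p 1))

/-- The action `Φ_{(g,X)}(v_p) = Tκ_g(p)(v_p + Tκ_p(e)X)` of `TG ≅ G ⋉ T_eG` on `TP`. -/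
def tangentAction (g : G) (X : GroupLieAlgebra IG G) (p : P) (v : TangentSpace IP p) :
    TangentSpace IP (B.κ p g) :=
  B.tangentRight g p (v + B.tangentOrbit p X)

/-- The subgroup `Aut_{TG} TP` of those elements of `Aut₀ TP` that commute with the action of
`TG` on `TP`. -/
def AutTG [FiniteDimensional ℝ EP] [IsManifold IP ∞ P] : Subgroup (FibreAut IP P) where
  carrier := {A | A ∈ Aut0 IP P ∧ ∀ (g : G) (X : GroupLieAlgebra IG G) (p : P)
    (v : TangentSpace IP p),
    A (B.κ p g) (B.tangentAction g X p v) = B.tangentAction g X p (A p v)}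
  one_mem' := ⟨one_mem _, fun _ _ _ _ => rfl⟩
  mul_mem' := by
    rintro A A' ⟨h, h1⟩ ⟨h', h1'⟩
    refine ⟨mul_mem h h', fun g X p v => ?_⟩
    change A _ (A' _ _) = B.tangentAction g X p (A p (A' p v))
    rw [h1', h1]
  inv_mem' := by
    rintro A ⟨h, h1⟩
    refine ⟨inv_mem h, fun g X p v => ?_⟩
    change (A _).symm _ = B.tangentAction g X p ((A p).symm v)
    rw [ContinuousLinearEquiv.symm_apply_eq, h1, ContinuousLinearEquiv.apply_symm_apply]

/-- The cotangent lift `Φ^*_g : T*P → T*P`, `Φ^*_g(φ)(pg) = (Tκ_g(p)⁻¹)^* φ` with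
`p = π^*(φ)`. -/
def cotangentLift [IsManifold IP 1 P] (g : G) : CotangentBundle IP P → CotangentBundle IP P :=
  fun φ => TotalSpace.mk (B.κ φ.1 g)
    (ContinuousLinearMap.comp φ.2 (B.tangentRight g φ.1).inverse)

/-- The fundamental vector fields `ξ^X` of the lifted action: `X ↦ ξ^X_φ` is the derivative at
`e` of the orbit map `g ↦ Φ^*_g(φ)`; here `Φ^*_e(φ) = φ`. -/
def cotangentFundamental [IsManifold IP ∞ P] (φ : CotangentBundle IP P) :
    GroupLieAlgebra IG G →L[ℝ] TangentSpace (cotModel IP) φ :=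
  (mfderiv IG (cotModel IP) (fun g => B.cotangentLift g φ) (1 : G) :
    TangentSpace IG (1 : G) →L[ℝ] TangentSpace (cotModel IP) (B.cotangentLift 1 φ))

/-- The momentum map `T*P → T_e^*G` belonging to the potential `γ` of the symplectic form `dγ`:
`⟨J(φ), X⟩ = ⟨γ_φ, ξ^X_φ⟩`. -/
def momentumMap [IsManifold IP ∞ P] (γ : OneForm (cotModel IP) (CotangentBundle IP P)) :
    CotangentBundle IP P → (GroupLieAlgebra IG G →L[ℝ] ℝ) :=
  fun φ => (γ φ).comp (B.cotangentFundamental φ)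

/-- The standard momentum map `J₀(φ) = φ ∘ Tκ_{π^*(φ)}(e)`. -/
def J0 [IsManifold IP 1 P] : CotangentBundle IP P → (GroupLieAlgebra IG G →L[ℝ] ℝ) :=
  fun φ => ContinuousLinearMap.comp φ.2 (B.tangentOrbit φ.1)

/-- `Can_{TG} T*P = Θ(Aut_{TG} TP)`. -/
def CanTG [FiniteDimensional ℝ EP] [IsManifold IP ∞ P] :
    Set (OneForm (cotModel IP) (CotangentBundle IP P)) :=
  Theta '' (B.AutTG : Set (FibreAut IP P))

end PrincipalBundle

end Principal

end GenCan

end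

open GenCan

/-
For `A, C ∈ Aut₀ TP` one has `L^*_A Θ(C) = Θ(AC)`, and `Θ : Aut₀ TP → Can T*P` is a bijection, so
`L^*` is the left regular action of `Aut₀ TP` on itself; freeness and (iii) follow.

Injectivity of `Θ`: the pair `(φ, Tπ^*(ξ))` may be prescribed arbitrarily, because every covector
extends to a local one-form. Surjectivity: a form `γ` in `Can T*P` only sees `Tπ^*(ξ)`, and every
tangent vector of `P` is the value of the base field `χ` of a linear vector field `(ξ, χ)`, namely
a coordinate field cut off by a bump function. So `γ` on the fibre over `p` is an injective linear
map from covectors to covectors, hence the transpose of some automorphism `A(p)` of `T_pP`;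
pulling `γ` back along local one-forms shows that `A` is smooth.

Finally, tested on all covectors, invariance of `Θ(A)` under the lifted action says that `A`
commutes with every `Tκ_g`, and `J_A = J₀` says that `A` fixes every `Tκ_p(e)X`. Together these
are the defining condition of `Aut_{TG} TP`.
-/

namespace GenCan

section Cotangent

variable {E : Type*} [NormedAddCommGroup E] [NormedSpace ℝ E]
  {H : Type*} [TopologicalSpace H] {I : ModelWithCorners ℝ E H}
  {X : Type*} [TopologicalSpace X] [ChartedSpace H X]
  {E' : Type*} [NormedAddCommGroup E'] [NormedSpace ℝ E']
  {H' : Type*} [TopologicalSpace H'] {I' : ModelWithCorners ℝ E' H'}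
  {Y : Type*} [TopologicalSpace Y] [ChartedSpace H' Y]
  {EN : Type*} [NormedAddCommGroup EN] [NormedSpace ℝ EN]
  {HN : Type*} [TopologicalSpace HN] {IN : ModelWithCorners ℝ EN HN}
  {N : Type*} [TopologicalSpace N] [ChartedSpace HN N]

theorem mfderiv_congr_point (f : X → Y) {x y : X} (h : x = y) (w : E) :
    (mfderiv I I' f x : E →L[ℝ] E') w = (mfderiv I I' f y : E →L[ℝ] E') w := by
  subst h; rfl

theorem ext_of_forall_cotangent {x : X} {v w : TangentSpace I x}
    (h : ∀ η : CotangentSpace I x, η v = η w) : v = w :=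
  (SeparatingDual.eq_iff_forall_dual_eq (R := ℝ) (V := E)).2 h

section OneManifold

variable [IsManifold I 1 X]

variable (I) in
/-- The preferred local trivialization of the tangent bundle at `q`. -/
noncomputable abbrev tangentTriv (q : X) : Trivialization E (π E (TangentSpace I : X → Type _)) :=
  trivializationAt E (TangentSpace I : X → Type _) q

theorem mem_baseSet_tangentTriv (q : X) : q ∈ (tangentTriv I q).baseSet :=
  FiberBundle.mem_baseSet_trivializationAt' q

theorem eventually_mem_baseSet_tangentTriv {q x : X} (hx : x ∈ (tangentTriv I q).baseSet) :
    ∀ᶠ x' in nhds x, x' ∈ (tangentTriv I q).baseSet :=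
  (tangentTriv I q).open_baseSet.mem_nhds hx

theorem OneForm.IsSmooth.apply {γ : OneForm I X} (hγ : γ.IsSmooth)
    {ξ : VField I X} (hξ : ξ.IsSmooth) : ContMDiff I 𝓘(ℝ, ℝ) ∞ (fun x => γ x (ξ x)) := by
  intro x
  have h := ContMDiff.clm_bundle_apply (B := X) (M := X) (IM := I) (IB := I) (n := ∞) (F₁ := E)
    (F₂ := ℝ) (E₁ := fun x => TangentSpace I x) (E₂ := Trivial X ℝ) (b := fun x => x)
    (ϕ := γ) (v := ξ) hγ hξ
  exact (contMDiffAt_totalSpace.1 (h x)).2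

end OneManifold

variable [IsManifold I ∞ X] [IsManifold I' ∞ Y]

theorem fibreCoord_eq (q : X) (ψ : CotangentBundle I X) :
    fibreCoord q ψ = ContinuousLinearMap.comp ψ.2 ((tangentTriv I q).symmL ℝ ψ.1) := by
  ext v
  simp [fibreCoord, hom_trivializationAt_apply, ContinuousLinearMap.inCoordinates]

theorem fibreCoord_comp {q x : X} {r y : Y} (hy : y ∈ (tangentTriv I' r).baseSet)
    (η : CotangentSpace I' y) (D : TangentSpace I x →L[ℝ] TangentSpace I' y) :
    fibreCoord q (TotalSpace.mk x (ContinuousLinearMap.comp η D) : CotangentBundle I X) =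
      (fibreCoord (I := I') r (TotalSpace.mk y η : CotangentBundle I' Y)).comp
        (ContinuousLinearMap.inCoordinates E (TangentSpace I : X → Type _) E'
          (TangentSpace I' : Y → Type _) q x r y D) := by
  rw [fibreCoord_eq, fibreCoord_eq]
  refine ContinuousLinearMap.ext fun v => ?_
  exact congrArg η ((tangentTriv I' r).symmL_continuousLinearMapAt hy _).symm

theorem contMDiffAt_cotangent {f : N → CotangentBundle I X} {n₀ : N} :
    ContMDiffAt IN (cotModel I) ∞ f n₀ ↔ ContMDiffAt IN I ∞ (fun n => (f n).1) n₀ ∧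
      ContMDiffAt IN 𝓘(ℝ, E →L[ℝ] ℝ) ∞ (fun n => fibreCoord (f n₀).1 (f n)) n₀ :=
  contMDiffAt_totalSpace

theorem contMDiffAt_cotangent_comp {b : N → X} {c : N → Y} {η : ∀ n, CotangentSpace I' (c n)}
    {D : ∀ n, TangentSpace I (b n) →L[ℝ] TangentSpace I' (c n)} {n₀ : N}
    (hb : ContMDiffAt IN I ∞ b n₀)
    (hη : ContMDiffAt IN (cotModel I') ∞
      (fun n => (TotalSpace.mk (c n) (η n) : CotangentBundle I' Y)) n₀)
    (hD : ContMDiffAt IN 𝓘(ℝ, E →L[ℝ] E') ∞ (inTangentCoordinates I I' b c D n₀) n₀) :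
    ContMDiffAt IN (cotModel I) ∞ (fun n =>
      (TotalSpace.mk (b n) (ContinuousLinearMap.comp (η n) (D n)) : CotangentBundle I X)) n₀ := by
  rw [contMDiffAt_cotangent] at hη ⊢
  refine ⟨hb, (hη.2.clm_comp hD).congr_of_eventuallyEq ?_⟩
  filter_upwards [hη.1.continuousAt.eventually
    (eventually_mem_baseSet_tangentTriv (mem_baseSet_tangentTriv (I := I') (c n₀)))] with n hn
  exact fibreCoord_comp hn (η n) (D n)

theorem contMDiff_cotProj : ContMDiff (cotModel I) I ∞ (cotProj I X) :=
  contMDiff_proj _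

theorem mdifferentiableAt_cotProj (φ : CotangentBundle I X) :
    MDifferentiableAt (cotModel I) I (cotProj I X) φ :=
  contMDiff_cotProj.mdifferentiableAt (by simp)

theorem contMDiffAt_fibreCoord {q : X} {ψ : CotangentBundle I X}
    (hψ : ψ.1 ∈ (tangentTriv I q).baseSet) :
    ContMDiffAt (cotModel I) 𝓘(ℝ, E →L[ℝ] ℝ) ∞ (fibreCoord q) ψ := by
  have h := (trivializationAt (E →L[ℝ] ℝ) (fun x : X => CotangentSpace I x) q).contMDiffAt_iff
    (IM := cotModel I) (IB := I) (n := ∞) (f := (id : CotangentBundle I X → _)) (x₀ := ψ) (by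
      rw [hom_trivializationAt_source]; exact ⟨hψ, trivial⟩)
  exact (h.1 contMDiffAt_id).2

/-- The one-form `σ`, as a map into the total space of the cotangent bundle. -/
def OneForm.toMap (σ : OneForm I X) : X → CotangentBundle I X := fun x => TotalSpace.mk x (σ x)

theorem OneForm.contMDiffAt_pullback {f : X → Y} {γ : OneForm I' Y} {x : X}
    (hγ : ContMDiffAt I' (cotModel I') ∞ γ.toMap (f x)) (hf : ContMDiffAt I I' ∞ f x) :
    ContMDiffAt I (cotModel I) ∞ (OneForm.pullback f γ : OneForm I X).toMap x :=
  contMDiffAt_cotangent_comp contMDiffAt_id (hγ.comp x hf)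
    (hf.mfderiv_const (m := ∞) le_rfl)

theorem mfderiv_cotProj_toMap {σ : OneForm I X} {x : X}
    (hσ : MDifferentiableAt I (cotModel I) σ.toMap x) (v : TangentSpace I x) :
    mfderiv (cotModel I) I (cotProj I X) (σ.toMap x) (mfderiv I (cotModel I) σ.toMap x v) = v := by
  have h := mfderiv_comp x (mdifferentiableAt_cotProj (σ.toMap x)) hσ
  have hid : cotProj I X ∘ σ.toMap = id := rfl
  rw [hid, mfderiv_id] at h
  exact (congrArg (fun T => T v) h).symm

variable (I) in
/-- A one-form through the covector `η` at `q` that is smooth near `q`: it is constant in the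
preferred trivialization of the cotangent bundle at `q`. -/
noncomputable def extendForm {q : X} (η : CotangentSpace I q) : OneForm I X :=
  fun x => FiberBundle.extend (E →L[ℝ] ℝ) (E := fun x : X => CotangentSpace I x) η x

theorem extendForm_self {q : X} (η : CotangentSpace I q) : extendForm I η q = η :=
  FiberBundle.extend_apply_self _ η

theorem contMDiffAt_extendForm {q : X} (η : CotangentSpace I q) :
    ContMDiffAt I (cotModel I) ∞ (extendForm I η).toMap q :=
  FiberBundle.contMDiffAt_extend I (E →L[ℝ] ℝ) η

theorem fibreCoord_extendForm {q x : X} (η : CotangentSpace I q)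
    (hx : x ∈ (tangentTriv I q).baseSet) :
    fibreCoord q ((extendForm I η).toMap x) =
      fibreCoord q (TotalSpace.mk q η : CotangentBundle I X) := by
  let e := trivializationAt (E →L[ℝ] ℝ) (fun x : X => CotangentSpace I x) q
  have h : x ∈ e.baseSet := by
    rw [hom_trivializationAt_baseSet]; exact ⟨hx, trivial⟩
  exact (congrArg Prod.snd (e.apply_mk_symm h (e (TotalSpace.mk q η)).2) :)

theorem mfderiv_cotProj_surjective (φ : CotangentBundle I X) :
    Function.Surjective (mfderiv (cotModel I) I (cotProj I X) φ) := by
  intro v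
  have hφ : (extendForm I φ.2).toMap φ.1 = φ :=
    congrArg (TotalSpace.mk φ.1) (extendForm_self φ.2)
  refine ⟨(mfderiv I (cotModel I) (extendForm I φ.2).toMap φ.1 v : E × (E →L[ℝ] ℝ)), ?_⟩
  exact (mfderiv_congr_point (cotProj I X) hφ _).symm.trans
    (mfderiv_cotProj_toMap ((contMDiffAt_extendForm φ.2).mdifferentiableAt (by simp)) v)

end Cotangent

section Theta

variable {E : Type*} [NormedAddCommGroup E] [NormedSpace ℝ E]
  {H : Type*} [TopologicalSpace H] {I : ModelWithCorners ℝ E H}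
  {P : Type*} [TopologicalSpace P] [ChartedSpace H P] [IsManifold I ∞ P]

theorem FibreAut.IsSmooth.inTangentCoordinates {A : FibreAut I P} (hA : A.IsSmooth)
    (φ₀ : CotangentBundle I P) :
    ContMDiffAt (cotModel I) 𝓘(ℝ, E →L[ℝ] E) ∞
      (inTangentCoordinates I I (cotProj I P) (cotProj I P)
        (fun φ => (A φ.1 : TangentSpace I φ.1 →L[ℝ] TangentSpace I φ.1)) φ₀) φ₀ :=
  (FibreAut.isSmooth_iff.1 hA φ₀.1).comp φ₀ (contMDiff_cotProj φ₀)

theorem FibreAut.IsSmooth.dual {A : FibreAut I P} (hA : A.IsSmooth) :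
    ContMDiff (cotModel I) (cotModel I) ∞ A.dual := fun φ =>
  contMDiffAt_cotangent_comp (contMDiff_cotProj φ) contMDiffAt_id (hA.inTangentCoordinates φ)

theorem FibreAut.IsSmooth.theta {A : FibreAut I P} (hA : A.IsSmooth) : (Theta A).IsSmooth :=
  fun φ => contMDiffAt_cotangent_comp (c := cotProj I P) (η := fun φ => (A.dual φ).2)
    (D := mfderiv (cotModel I) I (cotProj I P)) contMDiffAt_id (hA.dual φ)
    ((contMDiff_cotProj φ).mfderiv_const (m := ∞) le_rfl)

theorem mfderiv_cotProj_dual {A : FibreAut I P} (hA : A.IsSmooth) (φ : CotangentBundle I P)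
    (w : TangentSpace (cotModel I) φ) :
    mfderiv (cotModel I) I (cotProj I P) (A.dual φ)
      (mfderiv (cotModel I) (cotModel I) A.dual φ w) =
    mfderiv (cotModel I) I (cotProj I P) φ w := by
  have h := mfderiv_comp φ (mdifferentiableAt_cotProj (A.dual φ))
    (hA.dual.mdifferentiableAt (by simp))
  have hπ : cotProj I P ∘ A.dual = cotProj I P := rfl
  rw [hπ] at h
  exact (congrArg (fun T => T w) h).symm

theorem Theta_apply (A : FibreAut I P) (φ : CotangentBundle I P)
    (w : TangentSpace (cotModel I) φ) :
    Theta A φ w = φ.2 (A φ.1 (mfderiv (cotModel I) I (cotProj I P) φ w)) := rfl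

theorem Theta_one : Theta (1 : FibreAut I P) = canonicalForm I P := rfl

theorem Lstar_Theta {A : FibreAut I P} (hA : A.IsSmooth) (C : FibreAut I P) :
    Lstar A (Theta C) = Theta (A * C) := by
  funext φ
  refine ContinuousLinearMap.ext fun w => ?_
  exact congrArg (fun u => φ.2 (A φ.1 (C φ.1 u))) (mfderiv_cotProj_dual hA φ w)

theorem Theta_injective : Function.Injective (Theta : FibreAut I P → _) := by
  intro A C h
  funext p
  refine ContinuousLinearEquiv.ext (funext fun v => ext_of_forall_cotangent fun η => ?_)
  obtain ⟨w, rfl⟩ := mfderiv_cotProj_surjective (TotalSpace.mk p η : CotangentBundle I P) v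
  exact congrArg (fun γ => γ (TotalSpace.mk p η) w) h

theorem Theta_isGenCanonical {A : FibreAut I P} (hA : A.IsSmooth) :
    IsGenCanonical (Theta A) where
  smooth := hA.theta
  ne_zero φ hφ h := hφ <| ContinuousLinearMap.ext fun v => by
    obtain ⟨w, hw⟩ := mfderiv_cotProj_surjective φ ((A φ.1).symm v)
    have hΘ : Theta A φ w = 0 := congrArg (fun T => T w) h
    rwa [Theta_apply, hw, ContinuousLinearEquiv.apply_symm_apply] at hΘ
  ker_le φ w hw := by
    have hπ : mfderiv (cotModel I) I (cotProj I P) φ w = 0 := hw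
    change Theta A φ w = 0
    rw [Theta_apply, hπ]
    exact (congrArg φ.2 (A φ.1).map_zero).trans φ.2.map_zero
  linear ξ χ h := by
    refine ⟨hA.theta.apply h.smooth, fun p => ?_⟩
    simp only [Theta_apply, h.covers]
    exact ⟨fun _ _ => rfl, fun _ _ => rfl⟩

end Theta

section LinearVectorFields

section VectorValued

variable {E : Type*} [NormedAddCommGroup E] [NormedSpace ℝ E]
  {H : Type*} [TopologicalSpace H] {I : ModelWithCorners ℝ E H}
  {X : Type*} [TopologicalSpace X] [ChartedSpace H X]
  {F₁ F₂ F₃ : Type*} [NormedAddCommGroup F₁] [NormedSpace ℝ F₁]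
  [NormedAddCommGroup F₂] [NormedSpace ℝ F₂] [NormedAddCommGroup F₃] [NormedSpace ℝ F₃]
  {E' : Type*} [NormedAddCommGroup E'] [NormedSpace ℝ E']
  {H' : Type*} [TopologicalSpace H'] {I' : ModelWithCorners ℝ E' H'}
  {Y : Type*} [TopologicalSpace Y] [ChartedSpace H' Y]

theorem mvfderiv_comp_mfderiv {f : Y → F₁} {g : X → Y} {x : X} (w : TangentSpace I x)
    (hf : MDifferentiableAt I' 𝓘(ℝ, F₁) f (g x)) (hg : MDifferentiableAt I I' g x) :
    mvfderiv I (f ∘ g) x w = mvfderiv I' f (g x) (mfderiv I I' g x w) :=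
  congrArg (fun T : E →L[ℝ] F₁ => T w) (mfderiv_comp x hf hg)

theorem hasMFDerivAt_prodMk_space {f : X → F₁} {g : X → F₂} {x : X}
    {f' : TangentSpace I x →L[ℝ] F₁} {g' : TangentSpace I x →L[ℝ] F₂}
    (hf : HasMFDerivAt I 𝓘(ℝ, F₁) f x f') (hg : HasMFDerivAt I 𝓘(ℝ, F₂) g x g') :
    HasMFDerivAt I 𝓘(ℝ, F₁ × F₂) (fun y => (f y, g y)) x (f'.prod g') :=
  ⟨hf.1.prodMk hg.1, hf.2.prodMk hg.2⟩

theorem mvfderiv_prodMk {f : X → F₁} {g : X → F₂} {x : X} (w : TangentSpace I x)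
    (hf : MDifferentiableAt I 𝓘(ℝ, F₁) f x) (hg : MDifferentiableAt I 𝓘(ℝ, F₂) g x) :
    mvfderiv I (fun y => (f y, g y)) x w = (mvfderiv I f x w, mvfderiv I g x w) :=
  congrArg (fun T : E →L[ℝ] F₁ × F₂ => T w)
    (hasMFDerivAt_prodMk_space hf.hasMFDerivAt hg.hasMFDerivAt).mfderiv

theorem mvfderiv_clm_comp {f : X → F₂ →L[ℝ] F₃} {g : X → F₁ →L[ℝ] F₂} {x : X}
    (w : TangentSpace I x) (hf : MDifferentiableAt I 𝓘(ℝ, F₂ →L[ℝ] F₃) f x)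
    (hg : MDifferentiableAt I 𝓘(ℝ, F₁ →L[ℝ] F₂) g x) :
    mvfderiv I (fun y => (f y).comp (g y)) x w =
      (f x).comp (mvfderiv I g x w) + (mvfderiv I f x w).comp (g x) := by
  have hcomp := (isBoundedBilinearMap_comp (𝕜 := ℝ) (E := F₁) (F := F₂) (G := F₃)).hasFDerivAt
    (f x, g x)
  have h := hcomp.hasMFDerivAt.comp (f := fun y => (f y, g y)) x
    (hasMFDerivAt_prodMk_space hf.hasMFDerivAt hg.hasMFDerivAt)
  exact congrArg (fun T : E →L[ℝ] F₁ →L[ℝ] F₃ => T w) h.mfderiv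

end VectorValued

variable {E : Type*} [NormedAddCommGroup E] [NormedSpace ℝ E]
  {H : Type*} [TopologicalSpace H] {I : ModelWithCorners ℝ E H}

section ChartField

variable {X : Type*} [TopologicalSpace X] [ChartedSpace H X] [IsManifold I ∞ X]

variable (I) in
/-- The vector field on the chart domain at `q` that reads as the constant `v` in that chart. -/
noncomputable def chartField (q : X) (v : E) : VField I X :=
  fun x => (tangentTriv I q).symmL ℝ x v

theorem contMDiffOn_chartField (q : X) (v : E) :
    ContMDiffOn I I.tangent ∞
      (fun x => (TotalSpace.mk x (chartField I q v x) : TangentBundle I X))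
      (chartAt H q).source := by
  refine ((tangentTriv I q).contMDiffOn_section_baseSet_iff (IB := I) (n := ∞)
    (s := chartField I q v)).2 ((contMDiffOn_const (c := v)).congr fun x hx => ?_)
  have h := (tangentTriv I q).continuousLinearMapAt_symmL (R := ℝ) hx v
  rwa [Trivialization.continuousLinearMapAt_apply, Trivialization.linearMapAt_apply,
    if_pos hx] at h

theorem mvfderiv_extChartAt_chartField (q : X) (v : E) {x : X} (hx : x ∈ (chartAt H q).source) :
    mvfderiv I (extChartAt I q) x (chartField I q v x) = v := by
  change mfderiv I 𝓘(ℝ, E) (extChartAt I q) x (chartField I q v x) = v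
  rw [← TangentBundle.continuousLinearMapAt_trivializationAt hx]
  exact (tangentTriv I q).continuousLinearMapAt_symmL (R := ℝ) hx v

theorem chartField_mvfderiv_extChartAt (q : X) {x : X} (hx : x ∈ (chartAt H q).source)
    (w : TangentSpace I x) : chartField I q (mvfderiv I (extChartAt I q) x w) x = w := by
  change chartField I q (mfderiv I 𝓘(ℝ, E) (extChartAt I q) x w) x = w
  rw [← TangentBundle.continuousLinearMapAt_trivializationAt hx]
  exact (tangentTriv I q).symmL_continuousLinearMapAt (R := ℝ) hx w

end ChartField

variable {P : Type*} [TopologicalSpace P] [ChartedSpace H P]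

theorem bump_eq_zero [FiniteDimensional ℝ E] {p q : P} (ρ : SmoothBumpFunction I p)
    (hq : q ∉ (chartAt H p).source) : ρ q = 0 :=
  Function.notMem_support.1 fun h => hq (ρ.support_subset_source h)

variable [IsManifold I ∞ P]

theorem mem_chartAt_cotangent_source {ψ φ : CotangentBundle I P} :
    ψ ∈ (chartAt (ModelProd H (E →L[ℝ] ℝ)) φ).source ↔ ψ.1 ∈ (chartAt H φ.1).source := by
  rw [FiberBundle.chartedSpace_chartAt]
  simp [hom_trivializationAt_apply]

theorem extChartAt_cotangent (φ : CotangentBundle I P) :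
    (extChartAt (cotModel I) φ : CotangentBundle I P → E × (E →L[ℝ] ℝ)) =
      fun ψ => (extChartAt I φ.1 (cotProj I P ψ), fibreCoord φ.1 ψ) := by
  rw [FiberBundle.extChartAt]
  rfl

theorem mvfderiv_extChartAt_cotangent {φ ψ : CotangentBundle I P}
    (h : ψ.1 ∈ (chartAt H φ.1).source) (w : TangentSpace (cotModel I) ψ) :
    mvfderiv (cotModel I) (extChartAt (cotModel I) φ) ψ w =
      (mvfderiv I (extChartAt I φ.1) ψ.1 (mfderiv (cotModel I) I (cotProj I P) ψ w),
        mvfderiv (cotModel I) (fibreCoord φ.1) ψ w) := by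
  have hchart : MDifferentiableAt I 𝓘(ℝ, E) (extChartAt I φ.1) (cotProj I P ψ) :=
    mdifferentiableAt_extChartAt h
  rw [extChartAt_cotangent]
  exact (mvfderiv_prodMk w (hchart.comp ψ (mdifferentiableAt_cotProj ψ))
    ((contMDiffAt_fibreCoord h).mdifferentiableAt (by simp))).trans
    (congrArg (·, _) (mvfderiv_comp_mfderiv w hchart (mdifferentiableAt_cotProj ψ)))

theorem mvfderiv_fibreCoord_chartField (φ : CotangentBundle I P) (u : E × (E →L[ℝ] ℝ))
    {ψ : CotangentBundle I P} (h : ψ.1 ∈ (chartAt H φ.1).source) :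
    mvfderiv (cotModel I) (fibreCoord (I := I) φ.1) ψ (chartField (cotModel I) φ u ψ) = u.2 :=
  congrArg Prod.snd ((mvfderiv_extChartAt_cotangent h _).symm.trans
    (mvfderiv_extChartAt_chartField φ u (mem_chartAt_cotangent_source.2 h)))

theorem mfderiv_cotProj_chartField (φ : CotangentBundle I P) (u : E × (E →L[ℝ] ℝ))
    {ψ : CotangentBundle I P} (h : ψ.1 ∈ (chartAt H φ.1).source) :
    mfderiv (cotModel I) I (cotProj I P) ψ (chartField (cotModel I) φ u ψ) =
      chartField I φ.1 u.1 ψ.1 := by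
  have hfst := congrArg Prod.fst ((mvfderiv_extChartAt_cotangent h _).symm.trans
    (mvfderiv_extChartAt_chartField φ u (mem_chartAt_cotangent_source.2 h)))
  exact (chartField_mvfderiv_extChartAt φ.1 h _).symm.trans
    (congrArg (fun v : E => chartField I φ.1 v ψ.1) hfst)

variable (I) in
/-- The transition map from the preferred trivialization of the tangent bundle at `r` to the one
at `q`, as a function of the base point. -/
noncomputable abbrev tangentTransition (r q : P) : P → E →L[ℝ] E :=
  fun x => (tangentTriv I r).coordChangeL ℝ (tangentTriv I q) x

theorem fibreCoord_comp_tangentTransition {q r p : P} (hq : p ∈ (tangentTriv I q).baseSet)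
    (hr : p ∈ (tangentTriv I r).baseSet) (η : CotangentSpace I p) :
    fibreCoord r (TotalSpace.mk p η : CotangentBundle I P) =
      (fibreCoord (I := I) q (TotalSpace.mk p η : CotangentBundle I P)).comp
        (tangentTransition I r q p) := by
  refine (fibreCoord_comp hq η (ContinuousLinearMap.id ℝ (TangentSpace I p))).trans
    (congrArg _ (ContinuousLinearMap.ext fun v => ?_))
  rw [ContinuousLinearEquiv.coe_coe, Trivialization.coordChangeL_apply _ _ ⟨hr, hq⟩]
  change (tangentTriv I q).linearMapAt ℝ p ((tangentTriv I r).symmL ℝ p v) = _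
  rw [Trivialization.linearMapAt_apply, if_pos hq, Trivialization.symmL_apply _ hr]

theorem mvfderiv_fibreCoord_eq_add {q r : P} {φ : CotangentBundle I P}
    (hq : φ.1 ∈ (tangentTriv I q).baseSet) (hr : φ.1 ∈ (tangentTriv I r).baseSet)
    (w : TangentSpace (cotModel I) φ) :
    mvfderiv (cotModel I) (fibreCoord (I := I) r) φ w =
      (fibreCoord q φ).comp
        (mvfderiv I (tangentTransition I r q) φ.1
          (mfderiv (cotModel I) I (cotProj I P) φ w)) +
      (mvfderiv (cotModel I) (fibreCoord (I := I) q) φ w).comp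
        (tangentTransition I r q φ.1) := by
  let T := tangentTransition I r q
  have hT : MDifferentiableAt I 𝓘(ℝ, E →L[ℝ] E) T (cotProj I P φ) :=
    (contMDiffAt_coordChangeL (n := ∞) hr hq).mdifferentiableAt (by simp)
  have hπ := mdifferentiableAt_cotProj φ
  have hev : fibreCoord r =ᶠ[nhds φ] fun ψ => (fibreCoord q ψ).comp (T (cotProj I P ψ)) := by
    filter_upwards [contMDiff_cotProj.continuous.continuousAt.eventually
      ((eventually_mem_baseSet_tangentTriv hq).and (eventually_mem_baseSet_tangentTriv hr))]
      with ψ hψ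
    exact fibreCoord_comp_tangentTransition hψ.1 hψ.2 ψ.2
  have hcomp := mvfderiv_clm_comp w
    ((contMDiffAt_fibreCoord hq).mdifferentiableAt (by simp)) (hT.comp φ hπ)
  have hTw : mvfderiv (cotModel I) (T ∘ cotProj I P) φ w =
      mvfderiv I T φ.1 (mfderiv (cotModel I) I (cotProj I P) φ w) :=
    mvfderiv_comp_mfderiv w hT hπ
  rw [hTw] at hcomp
  exact (congrArg (fun D : E × (E →L[ℝ] ℝ) →L[ℝ] E →L[ℝ] ℝ => D w) hev.mfderiv_eq).trans hcomp

theorem isLinearMap_mvfderiv_fibreCoord {p q r : P} (hq : p ∈ (tangentTriv I q).baseSet)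
    (hr : p ∈ (tangentTriv I r).baseSet) {c : TangentSpace I p}
    {w : (η : CotangentSpace I p) →
      TangentSpace (cotModel I) (TotalSpace.mk p η : CotangentBundle I P)}
    (hw : ∀ η, mfderiv (cotModel I) I (cotProj I P) (TotalSpace.mk p η) (w η) = c)
    (hlin : IsLinearMap ℝ fun η =>
      mvfderiv (cotModel I) (fibreCoord (I := I) q) (TotalSpace.mk p η) (w η)) :
    IsLinearMap ℝ fun η =>
      mvfderiv (cotModel I) (fibreCoord (I := I) r) (TotalSpace.mk p η) (w η) := by
  have hderiv (η : CotangentSpace I p) :=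
    mvfderiv_fibreCoord_eq_add (φ := TotalSpace.mk p η) hq hr (w η)
  simp only [hderiv, hw]
  constructor
  · intro η η'
    simp only [fibreCoord_eq, hlin.map_add, ContinuousLinearMap.add_comp]
    abel
  · intro a η
    simp only [fibreCoord_eq, hlin.map_smul, ContinuousLinearMap.smul_comp, smul_add]

section Bump

variable [FiniteDimensional ℝ E] {p : P} (ρ : SmoothBumpFunction I p)

theorem isSmooth_bump_smul_chartField [T2Space P] (u : E) :
    VField.IsSmooth (I := I) fun x => ρ x • chartField I p u x :=
  ContMDiffOn.smul_section_of_tsupport ρ.contMDiff.contMDiffOn (chartAt H p).open_source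
    ρ.tsupport_subset_chartAt_source (contMDiffOn_chartField p u)

theorem isSmooth_bump_smul_chartField_cotangent [T2Space P] (u : E × (E →L[ℝ] ℝ)) :
    VField.IsSmooth (I := cotModel I) fun ψ : CotangentBundle I P =>
      ρ ψ.1 • chartField (cotModel I) (TotalSpace.mk p 0 : CotangentBundle I P) u ψ := by
  refine ContMDiffOn.smul_section_of_tsupport (u := cotProj I P ⁻¹' (chartAt H p).source)
    (ψ := fun ψ : CotangentBundle I P => ρ ψ.1)
    (ρ.contMDiff.comp contMDiff_cotProj).contMDiffOn
    ((chartAt H p).open_source.preimage contMDiff_cotProj.continuous) ?_ ?_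
  · exact (tsupport_comp_subset_preimage ρ contMDiff_cotProj.continuous).trans
      (Set.preimage_mono ρ.tsupport_subset_chartAt_source)
  · exact (contMDiffOn_chartField (TotalSpace.mk p 0 : CotangentBundle I P) u).mono
      fun ψ hψ => mem_chartAt_cotangent_source.2 hψ

theorem mfderiv_cotProj_bump_smul_chartField (u : E × (E →L[ℝ] ℝ)) (ψ : CotangentBundle I P) :
    mfderiv (cotModel I) I (cotProj I P) ψ
      (ρ ψ.1 • chartField (cotModel I) (TotalSpace.mk p 0 : CotangentBundle I P) u ψ) =
      ρ ψ.1 • chartField I p u.1 ψ.1 := by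
  refine ((mfderiv (cotModel I) I (cotProj I P) ψ).map_smul _ _).trans ?_
  by_cases h : ψ.1 ∈ (chartAt H p).source
  · exact congrArg (fun w : E => ρ ψ.1 • w) (mfderiv_cotProj_chartField (TotalSpace.mk p 0) u h)
  · rw [bump_eq_zero ρ h]
    exact (zero_smul ℝ (_ : E)).trans (zero_smul ℝ (_ : E)).symm

theorem isLinearMap_mvfderiv_bump_smul_chartField (u : E) (q : P) :
    IsLinearMap ℝ fun η : CotangentSpace I q =>
      mvfderiv (cotModel I) (fibreCoord (I := I) q) (TotalSpace.mk q η)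
        (ρ q • chartField (cotModel I) (TotalSpace.mk p 0 : CotangentBundle I P) (u, 0)
          (TotalSpace.mk q η)) := by
  by_cases h : q ∈ (chartAt H p).source
  · refine isLinearMap_mvfderiv_fibreCoord (q := p) (c := ρ q • chartField I p u q) h
      (mem_baseSet_tangentTriv q)
      (fun η => mfderiv_cotProj_bump_smul_chartField ρ (u, 0) (TotalSpace.mk q η)) ?_
    have hzero (η : CotangentSpace I q) := mvfderiv_fibreCoord_chartField
      (TotalSpace.mk p 0) (u, 0) (ψ := (TotalSpace.mk q η : CotangentBundle I P)) h
    simp only [ContinuousLinearMap.map_smul, hzero, smul_zero]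
    exact (0 : CotangentSpace I q →ₗ[ℝ] (E →L[ℝ] ℝ)).isLinear
  · simp only [bump_eq_zero ρ h, zero_smul, ContinuousLinearMap.map_zero]
    exact (0 : CotangentSpace I q →ₗ[ℝ] (E →L[ℝ] ℝ)).isLinear

variable [T2Space P]

theorem isLinVField_bump_smul_chartField (u : E) :
    IsLinVField (I := I) (fun ψ : CotangentBundle I P =>
        ρ ψ.1 • chartField (cotModel I) (TotalSpace.mk p 0 : CotangentBundle I P) (u, 0) ψ)
      (fun x => ρ x • chartField I p u x) where
  smooth := isSmooth_bump_smul_chartField_cotangent ρ (u, 0)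
  smooth_base := isSmooth_bump_smul_chartField ρ u
  covers := mfderiv_cotProj_bump_smul_chartField ρ (u, 0)
  linear := isLinearMap_mvfderiv_bump_smul_chartField ρ u

theorem exists_isLinVField (p : P) (v : TangentSpace I p) :
    ∃ (ξ : VField (cotModel I) (CotangentBundle I P)) (χ : VField I P),
      IsLinVField ξ χ ∧ χ p = v := by
  obtain ⟨ρ⟩ : Nonempty (SmoothBumpFunction I p) := inferInstance
  refine ⟨_, _, isLinVField_bump_smul_chartField ρ (mvfderiv I (extChartAt I p) p v), ?_⟩
  simp only [ρ.eq_one, chartField_mvfderiv_extChartAt p (mem_chart_source H p) v]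
  exact one_smul ℝ (v : E)

end Bump

end LinearVectorFields

section Surjectivity

theorem contMDiffAt_clm_of_forall_comp {E : Type*} [NormedAddCommGroup E] [NormedSpace ℝ E]
    {H : Type*} [TopologicalSpace H] {I : ModelWithCorners ℝ E H}
    {X : Type*} [TopologicalSpace X] [ChartedSpace H X]
    {F₁ F₂ : Type*} [NormedAddCommGroup F₁] [NormedSpace ℝ F₁]
    [NormedAddCommGroup F₂] [NormedSpace ℝ F₂] [FiniteDimensional ℝ F₂]
    {n : WithTop ℕ∞} {T : X → F₁ →L[ℝ] F₂} {x : X}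
    (h : ∀ c : F₂ →L[ℝ] ℝ, ContMDiffAt I 𝓘(ℝ, F₁ →L[ℝ] ℝ) n (fun y => c.comp (T y)) x) :
    ContMDiffAt I 𝓘(ℝ, F₁ →L[ℝ] F₂) n T x := by
  let b := Module.finBasis ℝ F₂
  let coord (i) : F₂ →L[ℝ] ℝ := LinearMap.toContinuousLinearMap (b.coord i)
  have hsum : T = fun y => ∑ i, (ContinuousLinearMap.smulRightL ℝ F₁ F₂).flip (b i)
      ((coord i).comp (T y)) := by
    funext y
    ext v
    simp [coord, b.sum_repr]
  rw [hsum]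
  exact ContMDiffAt.sum fun i _ =>
    (ContinuousLinearMap.contMDiffAt _).comp x (h (coord i))

theorem exists_continuousLinearEquiv_of_injective_to_dual {V : Type*} [AddCommGroup V] [Module ℝ V]
    [TopologicalSpace V] [IsTopologicalAddGroup V] [ContinuousSMul ℝ V] [T2Space V]
    [FiniteDimensional ℝ V] (T : (V →L[ℝ] ℝ) →ₗ[ℝ] Module.Dual ℝ V)
    (hT : Function.Injective T) : ∃ A : V ≃L[ℝ] V, ∀ η v, T η v = η (A v) := by
  let e : Module.Dual ℝ V ≃ₗ[ℝ] (V →L[ℝ] ℝ) := LinearMap.toContinuousLinearMap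
  let S : Module.Dual ℝ V →ₗ[ℝ] Module.Dual ℝ V := T ∘ₗ e.toLinearMap
  have hS : Function.Surjective S :=
    LinearMap.injective_iff_surjective.1 (hT.comp e.injective)
  let A : V →ₗ[ℝ] V :=
    (Module.evalEquiv ℝ V).symm.toLinearMap ∘ₗ S.dualMap ∘ₗ (Module.evalEquiv ℝ V).toLinearMap
  have hA (f : Module.Dual ℝ V) (v : V) : f (A v) = S f v := by
    simp [A]
  have hA_inj : Function.Injective A := by
    refine (injective_iff_map_eq_zero A).2 fun v hv =>
      (Module.forall_dual_apply_eq_zero_iff ℝ v).1 fun f => ?_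
    obtain ⟨f, rfl⟩ := hS f
    rw [← hA, hv, map_zero]
  exact ⟨(LinearEquiv.ofInjectiveEndo A hA_inj).toContinuousLinearEquiv, fun η v =>
    (hA (e.symm η) v).symm⟩

variable {E : Type*} [NormedAddCommGroup E] [NormedSpace ℝ E]
  {H : Type*} [TopologicalSpace H] {I : ModelWithCorners ℝ E H}
  {P : Type*} [TopologicalSpace P] [ChartedSpace H P] [IsManifold I ∞ P]

theorem pullback_toMap_Theta (A : FibreAut I P) {σ : OneForm I P} {p : P}
    (hσ : MDifferentiableAt I (cotModel I) σ.toMap p) :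
    (OneForm.pullback σ.toMap (Theta A) : OneForm I P) p =
      ContinuousLinearMap.comp (σ p) (A p : TangentSpace I p →L[ℝ] TangentSpace I p) :=
  ContinuousLinearMap.ext fun v => congrArg (fun u => σ p (A p u)) (mfderiv_cotProj_toMap hσ v)

theorem FibreAut.isSmooth_of_Theta_isSmooth [FiniteDimensional ℝ E] {A : FibreAut I P}
    (h : (Theta A).IsSmooth) : A.IsSmooth := by
  refine FibreAut.isSmooth_iff.2 fun q => contMDiffAt_clm_of_forall_comp fun c => ?_
  let σ : OneForm I P := extendForm I
    (ContinuousLinearMap.comp c ((tangentTriv I q).continuousLinearMapAt ℝ q))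
  have hσ : ContMDiffAt I (cotModel I) ∞ σ.toMap q := contMDiffAt_extendForm _
  have hc : fibreCoord q (TotalSpace.mk q (ContinuousLinearMap.comp c
      ((tangentTriv I q).continuousLinearMapAt ℝ q)) : CotangentBundle I P) = c := by
    rw [fibreCoord_eq]
    exact ContinuousLinearMap.ext fun v => congrArg c
      ((tangentTriv I q).continuousLinearMapAt_symmL (mem_baseSet_tangentTriv q) v)
  have hpull := (contMDiffAt_cotangent.1 (OneForm.contMDiffAt_pullback (h (σ.toMap q)) hσ)).2
  refine hpull.congr_of_eventuallyEq ?_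
  filter_upwards [eventually_mem_baseSet_tangentTriv (mem_baseSet_tangentTriv (I := I) q),
    (contMDiffAt_iff_contMDiffAt_nhds (n := 1) (by simp)).1 (hσ.of_le (by simp))] with p hp hσp
  refine (((congrArg (fun η => fibreCoord q (TotalSpace.mk p η : CotangentBundle I P))
    (pullback_toMap_Theta A (hσp.mdifferentiableAt (by simp)))).trans
    (fibreCoord_comp hp (σ p) _)).trans ?_).symm
  exact congrArg (fun c : E →L[ℝ] ℝ => c.comp _) ((fibreCoord_extendForm _ hp).trans hc)

theorem IsGenCanonical.apply_eq {γ : OneForm (cotModel I) (CotangentBundle I P)}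
    (hγ : IsGenCanonical γ) {φ : CotangentBundle I P} {w w' : TangentSpace (cotModel I) φ}
    (h : mfderiv (cotModel I) I (cotProj I P) φ w = mfderiv (cotModel I) I (cotProj I P) φ w') :
    γ φ w = γ φ w' :=
  LinearMap.sub_mem_ker_iff.1 (hγ.ker_le φ (LinearMap.sub_mem_ker_iff.2 h))

variable [FiniteDimensional ℝ E] [T2Space P]

theorem IsGenCanonical.exists_apply_eq {γ : OneForm (cotModel I) (CotangentBundle I P)}
    (hγ : IsGenCanonical γ) (p : P) :
    ∃ A : TangentSpace I p ≃L[ℝ] TangentSpace I p, ∀ (η : CotangentSpace I p)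
      (w : TangentSpace (cotModel I) (TotalSpace.mk p η : CotangentBundle I P)),
      γ (TotalSpace.mk p η) w =
        η (A (mfderiv (cotModel I) I (cotProj I P) (TotalSpace.mk p η) w)) := by
  have : T2Space (TangentSpace I p) := inferInstanceAs (T2Space E)
  have : FiniteDimensional ℝ (TangentSpace I p) := inferInstanceAs (FiniteDimensional ℝ E)
  choose ξ χ hξ hχ using exists_isLinVField (I := I) p
  have hπ (η : CotangentSpace I p) (v : TangentSpace I p) :
      mfderiv (cotModel I) I (cotProj I P) (TotalSpace.mk p η) (ξ v (TotalSpace.mk p η)) = v :=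
    ((hξ v).covers _).trans (hχ v)
  have hlin (v : TangentSpace I p) := (hγ.linear _ _ (hξ v)).2 p
  let T : CotangentSpace I p →ₗ[ℝ] Module.Dual ℝ (TangentSpace I p) := LinearMap.mk₂ ℝ
    (fun η v => γ (TotalSpace.mk p η) (ξ v (TotalSpace.mk p η)))
    (fun η η' v => (hlin v).map_add η η') (fun a η v => (hlin v).map_smul a η)
    (fun η v v' => (hγ.apply_eq (by
      rw [hπ, ContinuousLinearMap.map_add, hπ, hπ]; rfl)).trans (ContinuousLinearMap.map_add _ _ _))
    (fun a η v => (hγ.apply_eq (by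
      rw [hπ, ContinuousLinearMap.map_smul, hπ]; rfl)).trans (ContinuousLinearMap.map_smul _ _ _))
  have hT (η : CotangentSpace I p) (w) : γ (TotalSpace.mk p η) w =
      T η (mfderiv (cotModel I) I (cotProj I P) (TotalSpace.mk p η) w) :=
    hγ.apply_eq (hπ η _).symm
  have hT_inj : Function.Injective T := (injective_iff_map_eq_zero T).2 fun η hη => by
    by_contra hne
    refine hγ.ne_zero (TotalSpace.mk p η) hne (ContinuousLinearMap.ext fun w => ?_)
    rw [hT, hη]
    rfl
  obtain ⟨A, hA⟩ := exists_continuousLinearEquiv_of_injective_to_dual T hT_inj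
  exact ⟨A, fun η w => (hT η w).trans (hA η _)⟩

variable (I P) in
theorem Can_eq_image_Theta : Can I P = Theta '' (Aut0 I P : Set (FibreAut I P)) := by
  refine Set.Subset.antisymm (fun γ hγ => ?_) ?_
  · choose A hA using IsGenCanonical.exists_apply_eq hγ
    have hΘ : Theta A = γ :=
      funext fun φ => ContinuousLinearMap.ext fun w => (hA φ.1 φ.2 w).symm
    exact ⟨A, FibreAut.isSmooth_of_Theta_isSmooth (hΘ ▸ hγ.smooth), hΘ⟩
  · rintro _ ⟨A, hA, rfl⟩
    exact Theta_isGenCanonical hA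

variable (I P) in
theorem isFreeActionOn_Lstar : IsFreeActionOn (Aut0 I P) (Can I P) Lstar where
  maps A hA γ hγ := by
    rw [Can_eq_image_Theta] at hγ ⊢
    obtain ⟨C, hC, rfl⟩ := hγ
    exact ⟨A * C, mul_mem hA hC, (Lstar_Theta hA C).symm⟩
  one γ hγ := by
    rw [Can_eq_image_Theta] at hγ
    obtain ⟨C, -, rfl⟩ := hγ
    rw [Lstar_Theta FibreAut.isSmooth_one, one_mul]
  mul A hA A' hA' γ hγ := by
    rw [Can_eq_image_Theta] at hγ
    obtain ⟨C, -, rfl⟩ := hγ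
    rw [Lstar_Theta hA', Lstar_Theta hA, Lstar_Theta (mul_mem hA hA'), mul_assoc]
  free A hA γ hγ h := by
    rw [Can_eq_image_Theta] at hγ
    obtain ⟨C, -, rfl⟩ := hγ
    rw [Lstar_Theta hA] at h
    exact mul_eq_right.1 (Theta_injective h)

end Surjectivity

namespace PrincipalBundle

variable
    {EP : Type*} [NormedAddCommGroup EP] [NormedSpace ℝ EP]
    {HP : Type*} [TopologicalSpace HP] {IP : ModelWithCorners ℝ EP HP}
    {EM : Type*} [NormedAddCommGroup EM] [NormedSpace ℝ EM]
    {HM : Type*} [TopologicalSpace HM] {IM : ModelWithCorners ℝ EM HM}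
    {EG : Type*} [NormedAddCommGroup EG] [NormedSpace ℝ EG]
    {HG : Type*} [TopologicalSpace HG] {IG : ModelWithCorners ℝ EG HG}
    {P : Type*} [TopologicalSpace P] [ChartedSpace HP P]
    {M : Type*} [TopologicalSpace M] [ChartedSpace HM M]
    {G : Type*} [TopologicalSpace G] [ChartedSpace HG G] [Group G]
    (B : PrincipalBundle IP IM IG P M G)

theorem contMDiff_right (g : G) : ContMDiff IP IP ∞ (fun q => B.κ q g) :=
  B.smooth_κ.comp (contMDiff_id.prodMk contMDiff_const)

theorem mdifferentiableAt_right (g : G) (p : P) :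
    MDifferentiableAt IP IP (fun q => B.κ q g) p :=
  (B.contMDiff_right g).mdifferentiableAt (by simp)

theorem right_inv_right (p : P) (g : G) : B.κ (B.κ p g) g⁻¹ = p := by
  rw [← B.κ_mul, mul_inv_cancel, B.κ_one]

theorem right_right_inv (p : P) (g : G) : B.κ (B.κ p g⁻¹) g = p := by
  rw [← B.κ_mul, inv_mul_cancel, B.κ_one]

theorem tangentRight_tangentRight {g h : G} (hgh : ∀ q, B.κ (B.κ q g) h = q) (p : P)
    (v : TangentSpace IP p) :
    (B.tangentRight h (B.κ p g) (B.tangentRight g p v) : EP) = v := by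
  have hcomp := mfderiv_comp p (B.mdifferentiableAt_right h (B.κ p g))
    (B.mdifferentiableAt_right g p)
  have hid : (fun q => B.κ q h) ∘ (fun q => B.κ q g) = id := funext hgh
  rw [hid, mfderiv_id] at hcomp
  exact (congrArg (fun T : EP →L[ℝ] EP => T v) hcomp).symm

/-- `Tκ_g(p)` as an isomorphism, with inverse `Tκ_{g⁻¹}(pg)`. -/
noncomputable def tangentRightEquiv (g : G) (p : P) :
    TangentSpace IP p ≃L[ℝ] TangentSpace IP (B.κ p g) :=
  ContinuousLinearEquiv.equivOfInverse (M₁ := EP) (M₂ := EP) (B.tangentRight g p)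
    (B.tangentRight g⁻¹ (B.κ p g))
    (B.tangentRight_tangentRight (B.right_inv_right · g) p)
    (fun v => (mfderiv_congr_point (fun q => B.κ q g) (B.right_inv_right p g) _).symm.trans
      (B.tangentRight_tangentRight (B.right_right_inv · g) (B.κ p g) v))

theorem coe_tangentRightEquiv (g : G) (p : P) :
    (B.tangentRightEquiv g p : TangentSpace IP p →L[ℝ] TangentSpace IP (B.κ p g)) =
      B.tangentRight g p := rfl

theorem tangentRight_inverse (g : G) (p : P) :
    (B.tangentRight g p).inverse = (B.tangentRightEquiv g p).symm := by
  rw [← coe_tangentRightEquiv, ContinuousLinearMap.inverse_equiv]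

theorem tangentAction_zero (g : G) (p : P) (v : TangentSpace IP p) :
    B.tangentAction g (0 : GroupLieAlgebra IG G) p v = B.tangentRight g p v := by
  rw [tangentAction, ContinuousLinearMap.map_zero, add_zero]

variable [IsManifold IP ∞ P]

theorem cotangentLift_one (φ : CotangentBundle IP P) : B.cotangentLift (1 : G) φ = φ := by
  have h : ∀ f : P → P, f = id → (TotalSpace.mk (f φ.1)
      (ContinuousLinearMap.comp φ.2 (mfderiv IP IP f φ.1).inverse) : CotangentBundle IP P) = φ := by
    rintro f rfl
    rw [mfderiv_id, ContinuousLinearMap.inverse_id]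
    rfl
  exact h (fun q => B.κ q 1) (funext B.κ_one)

section Smooth

variable [LieGroup IG ∞ G]

theorem contMDiff_cotangentLift :
    ContMDiff ((cotModel IP).prod IG) (cotModel IP) ∞
      (fun x : CotangentBundle IP P × G => B.cotangentLift x.2 x.1) := by
  intro x₀
  have hbase : ContMDiff ((cotModel IP).prod IG) IP ∞
      (fun x : CotangentBundle IP P × G => B.κ x.1.1 x.2) :=
    B.smooth_κ.comp ((contMDiff_cotProj.comp contMDiff_fst).prodMk contMDiff_snd)
  have hinv : ContMDiff (((cotModel IP).prod IG).prod IP) IP ∞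
      (fun y : (CotangentBundle IP P × G) × P => B.κ y.2 y.1.2⁻¹) :=
    B.smooth_κ.comp (contMDiff_snd.prodMk ((contMDiff_inv IG ∞).comp
      (contMDiff_snd.comp contMDiff_fst)))
  have hD := ContMDiffAt.mfderiv (m := ∞) (fun (x : CotangentBundle IP P × G) q => B.κ q x.2⁻¹)
    (fun x => B.κ x.1.1 x.2) (hinv _) (hbase x₀) le_rfl
  have hpoint (x : CotangentBundle IP P × G) :
      (TotalSpace.mk (B.κ (B.κ x.1.1 x.2) x.2⁻¹) (x.1.2 : EP →L[ℝ] ℝ) :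
        CotangentBundle IP P) = x.1 :=
    congrArg (fun p => (TotalSpace.mk p (x.1.2 : EP →L[ℝ] ℝ) : CotangentBundle IP P))
      (B.right_inv_right x.1.1 x.2)
  refine (contMDiffAt_cotangent_comp (hbase x₀)
    (contMDiffAt_fst.congr_of_eventuallyEq (.of_forall hpoint)) hD).congr_of_eventuallyEq
    (.of_forall fun x => ?_)
  exact congrArg (fun T : EP →L[ℝ] EP => (TotalSpace.mk (B.κ x.1.1 x.2)
    (ContinuousLinearMap.comp (x.1.2 : EP →L[ℝ] ℝ) T) : CotangentBundle IP P))
    (B.tangentRight_inverse x.2 x.1.1)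

theorem mfderiv_cotProj_cotangentLift (g : G) (φ : CotangentBundle IP P)
    (w : TangentSpace (cotModel IP) φ) :
    mfderiv (cotModel IP) IP (cotProj IP P) (B.cotangentLift g φ)
      (mfderiv (cotModel IP) (cotModel IP) (B.cotangentLift g) φ w) =
    B.tangentRight g φ.1 (mfderiv (cotModel IP) IP (cotProj IP P) φ w) := by
  have hlift : ContMDiff (cotModel IP) (cotModel IP) ∞ (B.cotangentLift g) :=
    B.contMDiff_cotangentLift.comp (contMDiff_id.prodMk contMDiff_const)
  have h₁ := mfderiv_comp φ (mdifferentiableAt_cotProj (B.cotangentLift g φ))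
    (hlift.mdifferentiableAt (by simp))
  have h₂ := mfderiv_comp φ (B.mdifferentiableAt_right g φ.1) (mdifferentiableAt_cotProj φ)
  exact congrArg (fun T : EP × (EP →L[ℝ] ℝ) →L[ℝ] EP => T w) (h₁.symm.trans h₂)

theorem mfderiv_cotProj_cotangentFundamental (φ : CotangentBundle IP P)
    (X : GroupLieAlgebra IG G) :
    mfderiv (cotModel IP) IP (cotProj IP P) φ (B.cotangentFundamental φ X) =
      B.tangentOrbit φ.1 X := by
  have horbit : ContMDiff IG (cotModel IP) ∞ (fun g : G => B.cotangentLift g φ) :=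
    B.contMDiff_cotangentLift.comp (contMDiff_const.prodMk contMDiff_id)
  have hcomp := mfderiv_comp (1 : G) (mdifferentiableAt_cotProj (B.cotangentLift 1 φ))
    (horbit.mdifferentiableAt (by simp))
  exact (mfderiv_congr_point (cotProj IP P) (B.cotangentLift_one φ) _).symm.trans
    (congrArg (fun T : EG →L[ℝ] EP => T X) hcomp).symm

theorem pullback_cotangentLift_Theta (A : FibreAut IP P) (g : G) (φ : CotangentBundle IP P)
    (w : TangentSpace (cotModel IP) φ) :
    OneForm.pullback (B.cotangentLift g) (Theta A) φ w =
      φ.2 ((B.tangentRightEquiv g φ.1).symm (A (B.κ φ.1 g) (B.tangentRight g φ.1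
        (mfderiv (cotModel IP) IP (cotProj IP P) φ w)))) :=
  (congrArg (fun u => φ.2 ((B.tangentRight g φ.1).inverse (A (B.κ φ.1 g) u)))
    (B.mfderiv_cotProj_cotangentLift g φ w)).trans
    (congrArg (fun T : TangentSpace IP (B.κ φ.1 g) →L[ℝ] TangentSpace IP φ.1 => φ.2 (T _))
      (B.tangentRight_inverse g φ.1))

theorem pullback_Theta_eq_iff (A : FibreAut IP P) (g : G) :
    OneForm.pullback (B.cotangentLift g) (Theta A) = Theta A ↔
      ∀ (p : P) (v : TangentSpace IP p),
        A (B.κ p g) (B.tangentRight g p v) = B.tangentRight g p (A p v) := by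
  refine ⟨fun h p v => ?_, fun h => ?_⟩
  · refine ((B.tangentRightEquiv g p).symm_apply_eq).1 (ext_of_forall_cotangent fun η => ?_)
    obtain ⟨w, rfl⟩ := mfderiv_cotProj_surjective (TotalSpace.mk p η : CotangentBundle IP P) v
    exact (B.pullback_cotangentLift_Theta A g (TotalSpace.mk p η) w).symm.trans
      (congrArg (fun γ => γ (TotalSpace.mk p η) w) h)
  · funext φ
    refine ContinuousLinearMap.ext fun w => ?_
    exact (B.pullback_cotangentLift_Theta A g φ w).trans
      (congrArg φ.2 ((ContinuousLinearEquiv.symm_apply_eq _).2 (h φ.1 _)))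

theorem momentumMap_Theta (A : FibreAut IP P) : B.momentumMap (Theta A) = B.J0 ∘ A.dual := by
  funext φ
  refine ContinuousLinearMap.ext fun X => ?_
  exact congrArg (fun v => φ.2 (A φ.1 v)) (B.mfderiv_cotProj_cotangentFundamental φ X)

theorem momentumMap_Theta_eq_J0_iff (A : FibreAut IP P) :
    B.momentumMap (Theta A) = B.J0 ↔
      ∀ (p : P) (X : GroupLieAlgebra IG G), A p (B.tangentOrbit p X) = B.tangentOrbit p X := by
  rw [momentumMap_Theta]
  refine ⟨fun h p X => ext_of_forall_cotangent fun η => ?_, fun h => funext fun φ => ?_⟩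
  · exact congrArg (fun J => J (TotalSpace.mk p η) X) h
  · exact ContinuousLinearMap.ext fun X => congrArg φ.2 (h φ.1 X)

end Smooth

variable [FiniteDimensional ℝ EP]

theorem mem_AutTG_iff {A : FibreAut IP P} :
    A ∈ B.AutTG ↔ A ∈ Aut0 IP P ∧
      (∀ (g : G) (p : P) (v : TangentSpace IP p),
        A (B.κ p g) (B.tangentRight g p v) = B.tangentRight g p (A p v)) ∧
      ∀ (p : P) (X : GroupLieAlgebra IG G), A p (B.tangentOrbit p X) = B.tangentOrbit p X := by
  refine and_congr_right fun _ => ⟨fun h => ?_, fun h g X p v => ?_⟩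
  · have hright (g : G) (p : P) (v : TangentSpace IP p) :
        A (B.κ p g) (B.tangentRight g p v) = B.tangentRight g p (A p v) := by
      simpa only [tangentAction_zero] using h g 0 p v
    refine ⟨hright, fun p X => (B.tangentRightEquiv 1 p).injective ?_⟩
    have horbit := h 1 X p 0
    rwa [tangentAction, tangentAction, ContinuousLinearEquiv.map_zero, zero_add, hright] at horbit
  · rw [tangentAction, h.1, ContinuousLinearEquiv.map_add, h.2]
    rfl

theorem Theta_mem_CanTG_iff {A : FibreAut IP P} : Theta A ∈ B.CanTG ↔ A ∈ B.AutTG :=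
  Theta_injective.mem_set_image

theorem CanTG_eq_orbit :
    B.CanTG = {γ | ∃ A ∈ B.AutTG, Lstar A (canonicalForm IP P) = γ} := by
  ext γ
  refine exists_congr fun A => and_congr_right fun hA => ?_
  rw [← Theta_one, Lstar_Theta hA.1, mul_one]

theorem mem_AutTG_of_mapsTo_Lstar {A : FibreAut IP P} (hA : A ∈ Aut0 IP P)
    (h : Set.MapsTo (Lstar A) B.CanTG B.CanTG) : A ∈ B.AutTG := by
  have h₁ : Lstar A (Theta 1) ∈ B.CanTG := h ⟨1, one_mem _, rfl⟩
  rwa [Lstar_Theta hA, mul_one, B.Theta_mem_CanTG_iff] at h₁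

end PrincipalBundle

end GenCan

theorem proposition6_general
    {EP : Type*} [NormedAddCommGroup EP] [NormedSpace ℝ EP] [FiniteDimensional ℝ EP]
    {HP : Type*} [TopologicalSpace HP] (IP : ModelWithCorners ℝ EP HP)
    {EM : Type*} [NormedAddCommGroup EM] [NormedSpace ℝ EM]
    {HM : Type*} [TopologicalSpace HM] (IM : ModelWithCorners ℝ EM HM)
    {EG : Type*} [NormedAddCommGroup EG] [NormedSpace ℝ EG]
    {HG : Type*} [TopologicalSpace HG] (IG : ModelWithCorners ℝ EG HG)
    (P : Type*) [TopologicalSpace P] [T2Space P] [ChartedSpace HP P] [IsManifold IP ∞ P]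
    (M : Type*) [TopologicalSpace M] [ChartedSpace HM M]
    (G : Type*) [TopologicalSpace G] [ChartedSpace HG G] [Group G] [LieGroup IG ∞ G]
    (B : PrincipalBundle IP IM IG P M G) :
    (∀ A ∈ Aut0 IP P, Theta A ∈ Can IP P ∧ B.momentumMap (Theta A) = B.J0 ∘ A.dual) ∧
    (∀ A ∈ Aut0 IP P, Theta A ∈ B.CanTG ↔
      ((∀ g : G, OneForm.pullback (B.cotangentLift g) (Theta A) = Theta A) ∧
        B.momentumMap (Theta A) = B.J0)) ∧
    (IsFreeActionOn (Aut0 IP P) (Can IP P) Lstar ∧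
      B.CanTG = {γ | ∃ A ∈ B.AutTG, Lstar A (canonicalForm IP P) = γ}) ∧
    (∀ A ∈ Aut0 IP P, Set.MapsTo (Lstar A) B.CanTG B.CanTG → A ∈ B.AutTG) := by
  refine ⟨fun A hA => ⟨Theta_isGenCanonical hA, B.momentumMap_Theta A⟩, fun A hA => ?_,
    ⟨isFreeActionOn_Lstar IP P, B.CanTG_eq_orbit⟩, fun A => B.mem_AutTG_of_mapsTo_Lstar⟩
  rw [B.Theta_mem_CanTG_iff, B.mem_AutTG_iff, and_iff_right hA, B.momentumMap_Theta_eq_J0_iff]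
  simp only [B.pullback_Theta_eq_iff]

theorem proposition6
    {EP : Type*} [NormedAddCommGroup EP] [NormedSpace ℝ EP] [FiniteDimensional ℝ EP]
    {HP : Type*} [TopologicalSpace HP] (IP : ModelWithCorners ℝ EP HP) [IP.Boundaryless]
    {EM : Type*} [NormedAddCommGroup EM] [NormedSpace ℝ EM] [FiniteDimensional ℝ EM]
    {HM : Type*} [TopologicalSpace HM] (IM : ModelWithCorners ℝ EM HM) [IM.Boundaryless]
    {EG : Type*} [NormedAddCommGroup EG] [NormedSpace ℝ EG] [FiniteDimensional ℝ EG]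
    {HG : Type*} [TopologicalSpace HG] (IG : ModelWithCorners ℝ EG HG) [IG.Boundaryless]
    (P : Type*) [TopologicalSpace P] [T2Space P] [ChartedSpace HP P] [IsManifold IP ∞ P]
    (M : Type*) [TopologicalSpace M] [T2Space M] [ChartedSpace HM M] [IsManifold IM ∞ M]
    (G : Type*) [TopologicalSpace G] [ChartedSpace HG G] [Group G] [LieGroup IG ∞ G]
    (B : PrincipalBundle IP IM IG P M G) :
    -- `Θ(A)` is a generalized canonical form, and its momentum map is `J_A = J₀ ∘ A^*`
    (∀ A ∈ Aut0 IP P, Theta A ∈ Can IP P ∧ B.momentumMap (Theta A) = B.J0 ∘ A.dual) ∧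
    -- (i)
    (∀ A ∈ Aut0 IP P, Theta A ∈ B.CanTG ↔
      ((∀ g : G, OneForm.pullback (B.cotangentLift g) (Theta A) = Theta A) ∧
        B.momentumMap (Theta A) = B.J0)) ∧
    -- (ii)
    (IsFreeActionOn (Aut0 IP P) (Can IP P) Lstar ∧
      B.CanTG = {γ | ∃ A ∈ B.AutTG, Lstar A (canonicalForm IP P) = γ}) ∧
    -- (iii)
    (∀ A ∈ Aut0 IP P, Set.MapsTo (Lstar A) B.CanTG B.CanTG → A ∈ B.AutTG) :=
  proposition6_general IP IM IG P M G B
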